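/- All matroids are finite. A \emph{cycle} of a matroid $M$ on the ground set $E(M)$ is a (possibly empty) disjoint union of circuits of $M$, and $\mathrm{Cyc}(M)$ is the set of cycles of $M$. Let $\mathbb{K}$ be a field. The \emph{cycle algebra} of $M$ is the subalgebra $\mathbb{K}[\mathrm{Cyc}(M)]=\mathbb{K}[\mathbf{y}^C z : C\in\mathrm{Cyc}(M)]$ of the polynomial ring $\mathbb{K}[y_e,z : e\in E(M)]$, where $\mathbf{y}^C=\prod_{e\in C}y_e$. The \emph{cycle ideal} $I_{\mathrm{Cyc}(M)}$ is the kernel of the $\mathbb{K}$-algebra homomorphism $\mathbb{K}[x_C : C\in\mathrm{Cyc}(M)]\to\mathbb{K}[\mathrm{Cyc}(M)]$, $x_C\mapsto \mathbf{y}^C z$; it is homogeneous for the standard grading $\deg x_C=1$. Let $\mu(M)$ be the highest degree of an element of a minimal homogeneous generating set of $I_{\mathrm{Cyc}(M)}$, with $\mu(M)=-\infty$ if $I_{\mathrm{Cyc}(M)}=0$. A \emph{series contraction} of $M$ is a matroid $M/e$ where $e$ lies in a two-element cocircuit of $M$; a \emph{coloop contraction} of $M$ is a matroid $M/e$ where $e$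 is a coloop of $M$. A \emph{series minor} of $M$ is a matroid obtained from $M$ by a finite (possibly empty) sequence of deletions of elements and series contractions. A matroid is \emph{binary} if it is representable over the field with two elements. A \emph{binary matroidal retract} of a binary matroid $M$ is a matroid of the form $M/E'$, where $E=\{e_1,\dots,e_s\}$ and $E'=\{e'_1,\dots,e'_s\}$ are disjoint subsets of $E(M)$ with $|E|=|E'|=s\ge 1$ such that $E'$ is a circuit of $M$ and, for every circuit $C$ of $M$ and every proper subset $J$ of $\{1,\dots,s\}$, with $E_J=\{e_j:j\in J\}$ and $E'_J=\{e'_j:j\in J\}$: (i) if $C\cap E'=E'_J$, then $C\cap E=E_J$ or $C\cap E=E\setminus E_J$; (ii) if $C\cap E=E_J$, then $C\cap E'=E'_J$ or $C\cap E'=E'\setminus E'_J$. A \emph{g-series minor} of $M$ is a matroid obtained from $M$ by a finite (possibly empty) sequence of deletions of elements, series contractions, coloop contractions and binary matroidal retracts. \textbf{Theorem.} Let $M$ and $M'$ be matroids, and assume that one of the following holds: (a) $M'$ is a series minor of $M$; (b) $M$ is binary and $M'$ is a binary matroidal retract of $M$; or (c) $M$ is binary and $M'$ is a g-series minor of $M$.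 Then $\mu(M')\le\mu(M)$. -/

import Mathlib

open Matroid

namespace CycleIdeal

/-! ### Cycles and the cycle ideal of a matroid -/

/-- A cycle of `M` is a disjoint union of circuits of `M`; in particular the empty set is one. -/
def IsCycle {α : Type*} (M : Matroid α) (C : Set α) : Prop :=
  ∃ 𝒟 : Set (Set α), (∀ D ∈ 𝒟, M.IsCircuit D) ∧ 𝒟.PairwiseDisjoint id ∧ ⋃₀ 𝒟 = C

/-- `Cyc(M)`, the type of all cycles of `M`. -/
abbrev Cyc {α : Type*} (M : Matroid α) : Type _ := {C : Set α // IsCycle M C}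

/-- The monomial `y^C z` of the polynomial ring `R_M = K[y_e, z : e ∈ E(M)]`. The variable `y_e`
is `X (some e)` and the variable `z` is `X none`. -/
noncomputable def cycleMonomial {α : Type*} (K : Type*) [Field K] (M : Matroid α) (C : Cyc M) :
    MvPolynomial (Option M.E) K :=
  (∏ᶠ (e : M.E) (_ : (e : α) ∈ C.1), MvPolynomial.X (some e)) * MvPolynomial.X none

/-- The cycle algebra `K[Cyc(M)] = K[y^C z : C ∈ Cyc(M)]`, a subalgebra of `R_M`. -/
noncomputable def cycleAlgebra {α : Type*} (K : Type*) [Field K] (M : Matroid α) :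
    Subalgebra K (MvPolynomial (Option M.E) K) :=
  Algebra.adjoin K (Set.range (cycleMonomial K M))

/-- The presentation `φ_M : S_M = K[x_C : C ∈ Cyc(M)] → K[Cyc(M)]`, `x_C ↦ y^C z`. -/
noncomputable def cycleMap {α : Type*} (K : Type*) [Field K] (M : Matroid α) :
    MvPolynomial (Cyc M) K →ₐ[K] cycleAlgebra K M :=
  MvPolynomial.aeval fun C => ⟨cycleMonomial K M C, Algebra.subset_adjoin ⟨C, rfl⟩⟩

/-- The cycle ideal `I_{Cyc(M)}`, the kernel of `φ_M`. -/
noncomputable def cycleIdeal {α : Type*} (K : Type*) [Field K] (M : Matroid α) :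
    Ideal (MvPolynomial (Cyc M) K) :=
  RingHom.ker (cycleMap K M)

/-! ### The highest degree of a minimal homogeneous generator -/

/-- `G` is a minimal homogeneous generating set of the ideal `I` of a polynomial ring with its
standard grading: its elements are homogeneous, it generates `I`, and no proper subset of it
generates `I`. -/
def IsMinimalHomogeneousGenSet {σ K : Type*} [Field K] (I : Ideal (MvPolynomial σ K))
    (G : Set (MvPolynomial σ K)) : Prop :=
  (∀ g ∈ G, ∃ d : ℕ, g.IsHomogeneous d) ∧ Ideal.span G = I ∧
    ∀ G' : Set (MvPolynomial σ K), G' ⊂ G → Ideal.span G' ≠ I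

/-- `μ(M)`, the highest degree of an element of a minimal homogeneous generating set of the cycle
ideal of `M`. The only such set of the zero ideal is empty, so that `μ(M) = ⊥ = -∞` if the cycle
ideal is zero; an element of such a set is never zero, so that `totalDegree` is its degree. -/
noncomputable def mu {α : Type*} (K : Type*) [Field K] (M : Matroid α) : WithBot ℕ∞ :=
  sSup {d : WithBot ℕ∞ | ∃ G : Set (MvPolynomial (Cyc M) K),
    IsMinimalHomogeneousGenSet (cycleIdeal K M) G ∧ ∃ g ∈ G, d = ((g.totalDegree : ℕ∞) : WithBot ℕ∞)}

/-! ### Binary matroids and the various minors -/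

/-- `M` is binary: it is the vector matroid of a matrix over the field with two elements whose
columns are labelled by the ground set of `M`. -/
def IsBinary {α : Type*} (M : Matroid α) : Prop :=
  ∃ (m : ℕ) (A : Matrix (Fin m) M.E (ZMod 2)), ∀ I : Set M.E,
    M.Indep (Subtype.val '' I) ↔ LinearIndepOn (ZMod 2) (fun (e : M.E) (i : Fin m) => A i e) I

/-- `N` is the deletion of an element of `M`. -/
def IsDeletion {α : Type*} (M N : Matroid α) : Prop :=
  ∃ e ∈ M.E, N = M ＼ {e}

/-- `N = M / e` where `e` lies in a two-element cocircuit of `M`. -/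
def IsSeriesContraction {α : Type*} (M N : Matroid α) : Prop :=
  ∃ e f : α, e ≠ f ∧ M.IsCocircuit {e, f} ∧ N = M ／ {e}

/-- `N = M / e` where `e` is a coloop of `M`. -/
def IsColoopContraction {α : Type*} (M N : Matroid α) : Prop :=
  ∃ e : α, M.IsColoop e ∧ N = M ／ {e}

/-- `N` is a binary matroidal retract of `M`. The sets `E = {e_1, …, e_s}` and
`E' = {e'_1, …, e'_s}` are the ranges of `e` and `e'`, and `J` is the index set
`{i_1, …, i_p}` with `0 ≤ p < s`. -/
def IsBinaryMatroidalRetract {α : Type*} (M N : Matroid α) : Prop :=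
  IsBinary M ∧ ∃ (s : ℕ) (e e' : Fin s → α), 1 ≤ s ∧
    Function.Injective e ∧ Function.Injective e' ∧
    Set.range e ⊆ M.E ∧ Set.range e' ⊆ M.E ∧ Disjoint (Set.range e) (Set.range e') ∧
    M.IsCircuit (Set.range e') ∧
    (∀ C : Set α, M.IsCircuit C → ∀ J : Set (Fin s), J ≠ Set.univ →
      (C ∩ Set.range e' = e' '' J → C ∩ Set.range e = e '' J ∨ C ∩ Set.range e = e '' Jᶜ) ∧
      (C ∩ Set.range e = e '' J → C ∩ Set.range e' = e' '' J ∨ C ∩ Set.range e' = e' '' Jᶜ)) ∧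
    N = M ／ Set.range e'

/-- `M'` is a series minor of `M`: it is obtained by a finite sequence of deletions and series
contractions. -/
def IsSeriesMinor {α : Type*} (M M' : Matroid α) : Prop :=
  Relation.ReflTransGen (fun A B => IsDeletion A B ∨ IsSeriesContraction A B) M M'

/-- `M'` is a generalized series minor of `M`: it is obtained by a finite sequence of deletions,
series contractions, coloop contractions and binary matroidal retracts. -/
def IsGSeriesMinor {α : Type*} (M M' : Matroid α) : Prop :=
  Relation.ReflTransGen (fun A B => IsDeletion A B ∨ IsSeriesContraction A B ∨
    IsColoopContraction A B ∨ IsBinaryMatroidalRetract A B) M M'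

end CycleIdeal

namespace CycleIdeal

open MvPolynomial

/-! ### Graded ideals and minimal homogeneous generating sets -/

section Graded

variable {σ τ K : Type*} [Field K]

/-! Every operation makes the cycle algebra of the new matroid `N` a graded retract of that of `M`.
There is an inclusion `ι` of variables and a graded map `ρ` with `ρ ∘ ι = id`, and both carry one
cycle ideal into the other. Hence `ρ` maps the cycle ideal of `M` onto generators of that of `N`
without raising degrees (`mu_le_of_retract`).

Deletion is a face retract: put `y_t = 0` for deleted `t` (`mu_delete_le`); coloop contraction is
the same thing. For contractions of `T` (`mu_contract_le`), put `y_t = 1` for `t ∈ T`. The section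
exists when membership of `t` in a suitable lift of a cycle is dictated by membership of one
surviving element `q t`. For a series pair `{e, f}`, every circuit contains both or neither, so `q e
= f`. For a binary matroidal retract `q e'_j = e_j`: cycles are closed under symmetric difference,
every cycle meets `E` and `E'` in equal or complementary index sets, and adding the circuit `E'`
exchanges the two cases. -/

theorem isWeightedHomogeneous_aeval {w : τ → ℕ} {f : σ → MvPolynomial τ K}
    (hf : ∀ i, IsWeightedHomogeneous w (f i) 1) {p : MvPolynomial σ K} {n : ℕ}
    (hp : p.IsHomogeneous n) : IsWeightedHomogeneous w (aeval f p) n := by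
  rw [aeval_def, eval₂_eq]
  refine IsWeightedHomogeneous.sum _ _ _ fun d hd => ?_
  rw [algebraMap_eq]
  refine IsWeightedHomogeneous.C_mul ?_ _
  have h := IsWeightedHomogeneous.prod d.support (fun i => f i ^ d i) (fun i => d i • 1)
    fun i _ => (hf i).pow (d i)
  have hn : ∑ i ∈ d.support, d i • 1 = n := by
    simpa using (hp.degree_eq_sum_deg_support hd).symm
  rwa [hn] at h

/-- A substitution that sends variables to weight-one elements is graded, so its kernel is
homogeneous. -/
theorem aeval_homogeneousComponent {w : τ → ℕ} {f : σ → MvPolynomial τ K}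
    (hf : ∀ i, IsWeightedHomogeneous w (f i) 1) (p : MvPolynomial σ K) (n : ℕ) :
    aeval f (homogeneousComponent n p) = weightedHomogeneousComponent w n (aeval f p) := by
  have hd (m : ℕ) := isWeightedHomogeneous_aeval hf (homogeneousComponent_isHomogeneous m p)
  conv_rhs => rw [← sum_homogeneousComponent p, map_sum, map_sum]
  by_cases hn : n ∈ Finset.range (p.totalDegree + 1)
  · rw [Finset.sum_eq_single_of_mem n hn fun m _ hmn =>
      (hd m).weightedHomogeneousComponent_ne n hmn.symm]
    exact ((hd n).weightedHomogeneousComponent_same).symm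
  · rw [Finset.sum_eq_zero fun m hm =>
      (hd m).weightedHomogeneousComponent_ne n (by rintro rfl; exact hn hm)]
    rw [homogeneousComponent_eq_zero n p (by rw [Finset.mem_range] at hn; omega), map_zero]

attribute [local instance] MvPolynomial.gradedAlgebra

theorem homogeneousComponent_mem_span {S : Set (MvPolynomial σ K)}
    (hS : ∀ s ∈ S, ∃ d : ℕ, s.IsHomogeneous d) {p : MvPolynomial σ K} (hp : p ∈ Ideal.span S)
    (n : ℕ) : homogeneousComponent n p ∈ Ideal.span S :=
  homogeneousComponent_mem_of_mem (Ideal.homogeneous_span _ S hS) hp n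

theorem homogeneousComponent_mul_eq_zero {g : MvPolynomial σ K} {k d : ℕ} (hg : g.IsHomogeneous k)
    (hdk : d < k) (a : MvPolynomial σ K) : homogeneousComponent d (a * g) = 0 := by
  have h := DirectSum.coe_decompose_mul_of_right_mem_of_not_le (homogeneousSubmodule σ K) (a := a)
    (b := g) (n := d) ((mem_homogeneousSubmodule k g).2 hg) (not_le.2 hdk)
  rwa [← decomposition.decompose'_apply]

/-- A minimal homogeneous generating set has no element of degree larger than the degrees of
some other homogeneous generating set. -/
theorem IsMinimalHomogeneousGenSet.exists_totalDegree_le {I : Ideal (MvPolynomial σ K)}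
    {G S : Set (MvPolynomial σ K)} (hG : IsMinimalHomogeneousGenSet I G)
    (hS : ∀ s ∈ S, ∃ d : ℕ, s.IsHomogeneous d) (hSI : Ideal.span S = I) {g : MvPolynomial σ K}
    (hg : g ∈ G) : ∃ s ∈ S, g.totalDegree ≤ s.totalDegree := by
  by_contra! hlt
  obtain ⟨hhom, hspan, hmin⟩ := hG
  refine hmin (G \ {g}) (Set.sdiff_singleton_ssubset.2 hg) (le_antisymm ?_ ?_)
  · exact hspan ▸ Ideal.span_mono Set.sdiff_subset
  rw [← hSI, Ideal.span_le]
  intro s hs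
  obtain ⟨d, hd⟩ := hS s hs
  obtain ⟨k, hk⟩ := hhom g hg
  by_cases hs0 : s = 0
  · simp [hs0]
  have hg0 : g ≠ 0 := by
    rintro rfl
    simpa using hlt s hs
  have hdk : d < k := by
    have := hlt s hs
    rwa [hd.totalDegree hs0, hk.totalDegree hg0] at this
  have hsG : s ∈ Ideal.span (insert g (G \ {g})) := by
    rw [Set.insert_sdiff_singleton, Set.insert_eq_of_mem hg, hspan, ← hSI]
    exact Ideal.subset_span hs
  -- In degree `d < k` the multiple `a * g` contributes nothing, so `s` is the degree-`d` part of
  -- `b` and lies in the span of `G \ {g}`. This contradicts minimality of `G`.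
  obtain ⟨a, b, hb, rfl⟩ := Ideal.mem_span_insert.1 hsG
  have h := homogeneousComponent_mem_span (fun s hs => hhom s hs.1) hb d
  have h' : homogeneousComponent d (a * g + b) = a * g + b := homogeneousComponent_eq_self hd
  rw [map_add, homogeneousComponent_mul_eq_zero hk hdk, zero_add] at h'
  exact h' ▸ h

/-- By noetherianity finitely many homogeneous elements generate; an inclusion-minimal generating
subset of them is as required. -/
theorem exists_isMinimalHomogeneousGenSet [Finite σ] {I : Ideal (MvPolynomial σ K)}
    (hI : ∀ p ∈ I, ∀ n, homogeneousComponent n p ∈ I) :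
    ∃ G, IsMinimalHomogeneousGenSet I G := by
  let H : Set (MvPolynomial σ K) := {p | p ∈ I ∧ ∃ d : ℕ, p.IsHomogeneous d}
  have hH : Ideal.span H = I := by
    refine le_antisymm (Ideal.span_le.2 fun p hp => hp.1) fun p hp => ?_
    rw [← sum_homogeneousComponent p]
    exact Ideal.sum_mem _ fun n _ => Ideal.subset_span
      ⟨hI p hp n, n, homogeneousComponent_isHomogeneous n p⟩
  obtain ⟨T, hTH, hT⟩ := (Submodule.fg_span_iff_fg_span_finset_subset H).1
    (IsNoetherian.noetherian (Ideal.span H))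
  have hfin : {G : Set (MvPolynomial σ K) | G ⊆ T}.Finite := T.finite_toSet.finite_subsets
  obtain ⟨G, hG⟩ := (Set.Finite.subset (t := {G : Set (MvPolynomial σ K) | G ⊆ T ∧ Ideal.span G = I})
    hfin fun G hG => hG.1).exists_minimal ⟨T, subset_rfl, hT.symm.trans hH⟩
  refine ⟨G, fun g hg => (hTH (hG.prop.1 hg)).2, hG.prop.2, fun G' hG' h => ?_⟩
  exact hG'.2 (hG.le_of_le ⟨hG'.1.trans hG.prop.1, h⟩ hG'.1)

end Graded

/-! ### The cycle ideal inside a common polynomial ring -/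

section CommonRing

variable {α : Type*} (K : Type*) [Field K]

/-- The monomial `y^C z` of a set `C`, in the variables indexed by the whole type. -/
noncomputable def setMonomial (C : Set α) : MvPolynomial (Option α) K :=
  (∏ᶠ e ∈ C, X (some e)) * X none

variable {K}

theorem IsCycle.subset_ground {M : Matroid α} {C : Set α} (h : IsCycle M C) : C ⊆ M.E := by
  obtain ⟨𝒟, h𝒟, -, rfl⟩ := h
  exact Set.sUnion_subset fun D hD => (h𝒟 D hD).subset_ground

instance finite_cyc (M : Matroid α) [M.Finite] : Finite (Cyc M) :=
  (M.ground_finite.finite_subsets.subset fun _ hC => IsCycle.subset_ground hC).to_subtype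

theorem IsCycle.finite {M : Matroid α} [M.Finite] {C : Set α} (h : IsCycle M C) : C.Finite :=
  M.ground_finite.subset h.subset_ground

theorem rename_cycleMonomial (M : Matroid α) [M.Finite] (C : Cyc M) :
    rename (Option.map Subtype.val) (cycleMonomial K M C) = setMonomial K C.1 := by
  have hfin : (Subtype.val ⁻¹' C.1 : Set M.E).Finite :=
    C.2.finite.preimage Subtype.val_injective.injOn
  rw [cycleMonomial, setMonomial, map_mul, rename_X]
  congr 1
  have h := (rename (R := K) (Option.map (Subtype.val : M.E → α))).toMonoidHom.map_finprod_mem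
    (fun e : M.E => (X (some e) : MvPolynomial (Option M.E) K)) hfin
  refine h.trans ?_
  have himg : Subtype.val '' (Subtype.val ⁻¹' C.1 : Set M.E) = C.1 := by
    rw [Subtype.image_preimage_coe, Set.inter_eq_right.2 C.2.subset_ground]
  conv_rhs => rw [← himg]
  rw [finprod_mem_image Subtype.val_injective.injOn]
  simp

/-- With the variables indexed by all of `α`, maps between the cycle algebras of two matroids become
endomorphisms of a single ring. -/
theorem mem_cycleIdeal {M : Matroid α} [M.Finite] {p : MvPolynomial (Cyc M) K} :
    p ∈ cycleIdeal K M ↔ aeval (fun C : Cyc M => setMonomial K C.1) p = 0 := by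
  have hcomp : aeval (fun C : Cyc M => setMonomial K C.1) =
      ((rename (Option.map Subtype.val)).comp (cycleAlgebra K M).val).comp (cycleMap K M) := by
    ext1 C
    simp [cycleMap, rename_cycleMonomial]
  rw [cycleIdeal, RingHom.mem_ker, hcomp, AlgHom.comp_apply, AlgHom.comp_apply,
    map_eq_zero_iff _ (rename_injective _ (Option.map_injective Subtype.val_injective))]
  simp

/-- Only `z` carries weight, so all generators have weight one whatever the size of `C`. -/
theorem isWeightedHomogeneous_setMonomial {C : Set α} (hC : C.Finite) :
    IsWeightedHomogeneous (fun o : Option α => if o = none then 1 else 0) (setMonomial K C) 1 := by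
  classical
  rw [setMonomial, finprod_mem_eq_finite_toFinset_prod _ hC]
  have h := (IsWeightedHomogeneous.prod hC.toFinset
    (fun e => (X (some e) : MvPolynomial (Option α) K)) (fun _ => 0)
    (w := fun o : Option α => if o = none then 1 else 0) fun e _ => by
      simpa using isWeightedHomogeneous_X K (fun o : Option α => if o = none then 1 else 0)
        (some e)).mul (isWeightedHomogeneous_X K (fun o : Option α => if o = none then 1 else 0)
          none)
  simpa using h

theorem homogeneousComponent_mem_cycleIdeal {M : Matroid α} [M.Finite]
    (p : MvPolynomial (Cyc M) K) (hp : p ∈ cycleIdeal K M) (n : ℕ) :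
    homogeneousComponent n p ∈ cycleIdeal K M := by
  classical
  rw [mem_cycleIdeal] at hp ⊢
  rw [aeval_homogeneousComponent fun C : Cyc M => isWeightedHomogeneous_setMonomial C.2.finite,
    hp, map_zero]

/-- If the cycle algebra of `N` is a graded algebra retract of that of `M`, by maps which send
variables to variables or to zero, then `μ(N) ≤ μ(M)`. -/
theorem mu_le_of_retract {M N : Matroid α} [M.Finite] [N.Finite] (ι : Cyc N → Cyc M)
    (ρ : Cyc M → MvPolynomial (Cyc N) K) (hρ : ∀ C, (ρ C).IsHomogeneous 1)
    (hρι : ∀ D, ρ (ι D) = X D) (f g : MvPolynomial (Option α) K →ₐ[K] MvPolynomial (Option α) K)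
    (hf : ∀ D, f (setMonomial K D.1) = setMonomial K (ι D).1)
    (hg : ∀ C, g (setMonomial K C.1) = aeval (fun D : Cyc N => setMonomial K D.1) (ρ C)) :
    mu K N ≤ mu K M := by
  have hι_mem : ∀ p ∈ cycleIdeal K N, aeval (fun D => X (ι D)) p ∈ cycleIdeal K M := by
    intro p hp
    rw [mem_cycleIdeal] at hp ⊢
    have : (aeval (fun C : Cyc M => setMonomial K C.1)).comp (aeval fun D => X (ι D)) =
        f.comp (aeval (fun D : Cyc N => setMonomial K D.1)) := by
      ext1 D
      simp [hf]
    have := DFunLike.congr_fun this p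
    simp only [AlgHom.comp_apply] at this
    rw [this, hp, map_zero]
  have hρ_mem : ∀ p ∈ cycleIdeal K M, aeval ρ p ∈ cycleIdeal K N := by
    intro p hp
    rw [mem_cycleIdeal] at hp ⊢
    have : (aeval (fun C : Cyc N => setMonomial K C.1)).comp (aeval ρ) =
        g.comp (aeval (fun D : Cyc M => setMonomial K D.1)) := by
      ext1 D
      simp [hg]
    have := DFunLike.congr_fun this p
    simp only [AlgHom.comp_apply] at this
    rw [this, hp, map_zero]
  have hid : ∀ p, aeval ρ (aeval (fun D => (X (ι D) : MvPolynomial (Cyc M) K)) p) = p := by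
    intro p
    have : (aeval ρ).comp (aeval fun D => (X (ι D) : MvPolynomial (Cyc M) K)) =
        AlgHom.id K (MvPolynomial (Cyc N) K) := by
      ext1 D
      simp [hρι]
    exact DFunLike.congr_fun this p
  obtain ⟨G, hG⟩ := exists_isMinimalHomogeneousGenSet
    (homogeneousComponent_mem_cycleIdeal (K := K) (M := M))
  have hhom : ∀ p : MvPolynomial (Cyc M) K, ∀ d, p.IsHomogeneous d →
      (aeval ρ p).IsHomogeneous d := fun p d hp => by simpa using hp.aeval ρ hρ
  -- For `p` in the ideal of `N`, write its image under `ι` in terms of `G` and apply `ρ`, which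
  -- returns `p`.
  have hspan : Ideal.span (aeval ρ '' G) = cycleIdeal K N := by
    refine le_antisymm (Ideal.span_le.2 ?_) fun p hp => ?_
    · rintro _ ⟨q, hq, rfl⟩
      exact hρ_mem q (hG.2.1 ▸ Ideal.subset_span hq)
    · have h := Ideal.mem_map_of_mem (aeval ρ) (hG.2.1.symm ▸ hι_mem p hp)
      rwa [Ideal.map_span, hid] at h
  refine sSup_le ?_
  rintro _ ⟨G', hG', g', hg', rfl⟩
  obtain ⟨_, ⟨q, hq, rfl⟩, hle⟩ := hG'.exists_totalDegree_le (S := aeval ρ '' G) (by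
    rintro _ ⟨q, hq, rfl⟩
    obtain ⟨d, hd⟩ := hG.1 q hq
    exact ⟨d, hhom q d hd⟩) hspan hg'
  refine le_trans ?_ (le_sSup ⟨G, hG, q, hq, rfl⟩)
  obtain ⟨d, hd⟩ := hG.1 q hq
  have hq0 : q ≠ 0 := by
    rintro rfl
    refine hG.2.2 (G \ {0}) (Set.sdiff_singleton_ssubset.2 hq) ?_
    rw [Ideal.span_sdiff_singleton_zero, hG.2.1]
  have hle' : g'.totalDegree ≤ q.totalDegree := by
    rw [hd.totalDegree hq0]
    exact hle.trans (hhom q d hd).totalDegree_le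
  exact_mod_cast hle'

end CommonRing

/-! ### Retracts of cycle algebras from deletions and contractions -/

section Minors

variable {α K : Type*} [Field K]

theorem aeval_setMonomial (F : Option α → MvPolynomial (Option α) K) {C : Set α} (hC : C.Finite) :
    aeval F (setMonomial K C) = (∏ᶠ e ∈ C, F (some e)) * F none := by
  rw [setMonomial, map_mul, aeval_X]
  congr 1
  refine ((aeval (R := K) F).toMonoidHom.map_finprod_mem
    (fun e : α => (X (some e) : MvPolynomial (Option α) K)) hC).trans ?_
  simp

theorem isCycle_delete_iff {M : Matroid α} {D C : Set α} :
    IsCycle (M ＼ D) C ↔ IsCycle M C ∧ Disjoint C D := by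
  constructor
  · rintro ⟨𝒟, h, hd, rfl⟩
    refine ⟨⟨𝒟, fun X hX => (h X hX).of_delete, hd, rfl⟩, ?_⟩
    exact Set.disjoint_sUnion_left.2 fun X hX => (delete_isCircuit_iff.1 (h X hX)).2
  · rintro ⟨⟨𝒟, h, hd, rfl⟩, hdisj⟩
    exact ⟨𝒟, fun X hX => delete_isCircuit_iff.2 ⟨h X hX, Set.disjoint_sUnion_left.1 hdisj X hX⟩,
      hd, rfl⟩

theorem mu_delete_le (M : Matroid α) [M.Finite] (T : Set α) : mu K (M ＼ T) ≤ mu K M := by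
  classical
  refine mu_le_of_retract (fun D => ⟨D.1, (isCycle_delete_iff.1 D.2).1⟩)
    (fun C => if h : Disjoint C.1 T then X ⟨C.1, isCycle_delete_iff.2 ⟨C.2, h⟩⟩ else 0)
    (fun C => ?_) (fun D => ?_) (AlgHom.id K _)
    (aeval fun o => o.elim (X none) fun a => if a ∈ T then 0 else X (some a))
    (fun D => rfl) (fun C => ?_)
  · split_ifs
    exacts [isHomogeneous_X _ _, isHomogeneous_zero _ _ _]
  · simp [(isCycle_delete_iff.1 D.2).2]
  · rw [aeval_setMonomial _ C.2.finite]
    split_ifs with h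
    · rw [aeval_X, setMonomial]
      congr 1
      exact finprod_mem_congr rfl fun a ha => by simp [Set.disjoint_left.1 h ha]
    · obtain ⟨a, haC, haT⟩ := Set.not_disjoint_iff.1 h
      rw [finprod_mem_eq_finite_toFinset_prod _ C.2.finite,
        Finset.prod_eq_zero (i := a) (by simpa using haC) (by simp [haT]), zero_mul, map_zero]

theorem mu_contract_le {M : Matroid α} [M.Finite] {T : Set α} (hT : T ⊆ M.E) (q : α → α)
    (hproj : ∀ C, IsCycle M C → IsCycle (M ／ T) (C \ T))
    (hlift : ∀ D, IsCycle (M ／ T) D → IsCycle M (D ∪ {t | t ∈ T ∧ q t ∈ D})) :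
    mu K (M ／ T) ≤ mu K M := by
  classical
  have hTfin : T.Finite := M.ground_finite.subset hT
  have hdisj {D : Set α} (hD : IsCycle (M ／ T) D) : Disjoint D T :=
    (Set.subset_sdiff.1 (contract_ground M T ▸ hD.subset_ground)).2
  -- The section sends `y_a` to the product of `y_x` over `a` and the fibre of `q` at `a`. These
  -- blocks are disjoint for distinct `a` in a cycle of `M ／ T`, which avoids `T`.
  let U : α → Set α := fun a => insert a {t | t ∈ T ∧ q t = a}
  have hU (a : α) : (U a).Finite := (hTfin.subset fun t ht => ht.1).insert a
  refine mu_le_of_retract (fun D => ⟨_, hlift D.1 D.2⟩)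
    (fun C => X ⟨_, hproj C.1 C.2⟩) (fun C => isHomogeneous_X _ _) (fun D => ?_)
    (aeval fun o => o.elim (X none) fun a => ∏ᶠ x ∈ U a, X (some x))
    (aeval fun o => o.elim (X none) fun a => if a ∈ T then 1 else X (some a))
    (fun D => ?_) (fun C => ?_)
  · congr 1
    refine Subtype.ext ?_
    have := Set.disjoint_left.1 (hdisj D.2)
    ext x
    simp only [Set.mem_sdiff, Set.mem_union, Set.mem_ofPred_eq]
    have := @this x
    tauto
  · have hset : D.1 ∪ {t | t ∈ T ∧ q t ∈ D.1} = ⋃ a ∈ D.1, U a := by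
      ext x
      simp only [Set.mem_union, Set.mem_ofPred_eq, Set.mem_iUnion, U, Set.mem_insert_iff,
        exists_prop]
      constructor
      · rintro (hx | ⟨hx, hq⟩)
        exacts [⟨x, hx, Or.inl rfl⟩, ⟨q x, hq, Or.inr ⟨hx, rfl⟩⟩]
      · rintro ⟨a, ha, rfl | ⟨hx, rfl⟩⟩
        exacts [Or.inl ha, Or.inr ⟨hx, ha⟩]
    rw [aeval_setMonomial _ D.2.finite]
    simp only [hset, setMonomial, Option.elim]
    rw [finprod_mem_biUnion _ D.2.finite fun a _ => hU a]
    intro a ha b hb hab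
    have h1 := Set.disjoint_left.1 (hdisj D.2) ha
    have h2 := Set.disjoint_left.1 (hdisj D.2) hb
    refine Set.disjoint_left.2 ?_
    rintro x (rfl | ⟨hx, rfl⟩) (hxb | ⟨hx', hxb⟩)
    · exact hab hxb
    · exact h1 hx'
    · exact h2 (hxb ▸ hx)
    · exact hab hxb
  · rw [aeval_setMonomial _ C.2.finite, aeval_X, setMonomial]
    congr 1
    rw [← finprod_mem_inter_mul_sdiff T C.2.finite]
    rw [finprod_mem_congr rfl (g := fun _ => 1) fun a ha => by simp [ha.2], finprod_mem_one,
      one_mul]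
    exact finprod_mem_congr rfl fun a ha => by simp [ha.2]

/-! ### Series contractions -/

theorem mem_iff_mem_of_isCocircuit_pair {M : Matroid α} {e f : α} (h : M.IsCocircuit {e, f})
    {C : Set α} (hC : M.IsCircuit C) : e ∈ C ↔ f ∈ C := by
  rcases hC.isCocircuit_disjoint_or_nontrivial_inter h with hd | hn
  · have h1 := Set.disjoint_right.1 hd (Set.mem_insert e {f})
    have h2 := Set.disjoint_right.1 hd (Set.mem_insert_of_mem e (Set.mem_singleton f))
    tauto
  · obtain ⟨x, ⟨hx, hx'⟩, y, ⟨hy, hy'⟩, hxy⟩ := hn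
    rcases hx' with rfl | rfl <;> rcases hy' with rfl | rfl <;> tauto

/-- A circuit of `M ／ {e}` inside `C \ {e}` lifts to a circuit of `M` that can use `e` only together
with `f`. That lift therefore stays inside `C` and equals `C`. -/
theorem isCircuit_contract_of_isCocircuit_pair {M : Matroid α} {e f : α} (hef : e ≠ f)
    (h : M.IsCocircuit {e, f}) {C : Set α} (hC : M.IsCircuit C) :
    (M ／ {e}).IsCircuit (C \ {e}) := by
  have hnot : ¬ C ⊆ {e} := by
    intro hss
    obtain ⟨x, hx⟩ := hC.nonempty
    have hxe : x = e := hss hx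
    exact hef (hss ((mem_iff_mem_of_isCocircuit_pair h hC).1 (hxe ▸ hx))).symm
  obtain ⟨D, hDC, hD⟩ := (hC.contract_dep_of_not_subset hnot).exists_isCircuit_subset
  obtain ⟨C', hC', hDC', hC'D⟩ := hD.exists_subset_isCircuit_of_contract
  have hsub : C' ⊆ C := by
    intro x hx
    rcases hC'D hx with hxD | rfl
    · exact (hDC hxD).1
    · have hf := (mem_iff_mem_of_isCocircuit_pair h hC').1 hx
      rcases hC'D hf with hfD | hfe
      · exact (mem_iff_mem_of_isCocircuit_pair h hC).2 (hDC hfD).1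
      · exact absurd hfe.symm hef
  obtain rfl := hC'.eq_of_subset_isCircuit hC hsub
  have : D = C' \ {e} := hDC.antisymm fun x hx => (hC'D hx.1).resolve_right hx.2
  exact this ▸ hD

theorem isCircuit_of_contract_of_isCocircuit_pair {M : Matroid α} {e f : α} (hef : e ≠ f)
    (h : M.IsCocircuit {e, f}) {D : Set α} (hD : (M ／ {e}).IsCircuit D) :
    M.IsCircuit (D ∪ {t | t ∈ ({e} : Set α) ∧ f ∈ D}) := by
  obtain ⟨C, hC, hDC, hCD⟩ := hD.exists_subset_isCircuit_of_contract
  have hiff := mem_iff_mem_of_isCocircuit_pair h hC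
  convert hC using 1
  refine Set.Subset.antisymm (Set.union_subset hDC ?_) fun x hx => ?_
  · rintro x ⟨rfl, hf⟩
    exact hiff.2 (hDC hf)
  · rcases hCD hx with hxD | rfl
    · exact Or.inl hxD
    · exact Or.inr ⟨rfl, (hCD (hiff.1 hx)).resolve_right fun hfe => hef hfe.symm⟩

theorem mu_series_contract_le {M : Matroid α} [M.Finite] {e f : α} (hef : e ≠ f)
    (h : M.IsCocircuit {e, f}) : mu K (M ／ {e}) ≤ mu K M := by
  refine mu_contract_le (Set.singleton_subset_iff.2 (h.subset_ground (Set.mem_insert e {f})))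
    (fun _ => f) ?_ ?_
  · rintro _ ⟨𝒟, h𝒟, hd, rfl⟩
    refine ⟨(· \ {e}) '' 𝒟, ?_, ?_, ?_⟩
    · rintro _ ⟨X, hX, rfl⟩
      exact isCircuit_contract_of_isCocircuit_pair hef h (h𝒟 X hX)
    · rintro _ ⟨X, hX, rfl⟩ _ ⟨Y, hY, rfl⟩ hne
      exact (hd hX hY (by rintro rfl; exact hne rfl)).mono Set.sdiff_subset Set.sdiff_subset
    · ext x
      simp only [Set.mem_sUnion, Set.exists_mem_image, Set.mem_sdiff]
      tauto
  · rintro _ ⟨𝒟, h𝒟, hd, rfl⟩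
    refine ⟨(fun X => X ∪ {t | t ∈ ({e} : Set α) ∧ f ∈ X}) '' 𝒟, ?_, ?_, ?_⟩
    · rintro _ ⟨X, hX, rfl⟩
      exact isCircuit_of_contract_of_isCocircuit_pair hef h (h𝒟 X hX)
    · rintro _ ⟨X, hX, rfl⟩ _ ⟨Y, hY, rfl⟩ hne
      have hXY := Set.disjoint_left.1 (hd hX hY (by rintro rfl; exact hne rfl))
      have he {Z : Set α} (hZ : Z ∈ 𝒟) : e ∉ Z := fun heZ =>
        ((contract_ground M {e} ▸ (h𝒟 Z hZ).subset_ground) heZ).2 rfl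
      refine Set.disjoint_left.2 ?_
      rintro x (hx | ⟨rfl, hx⟩) (hy | ⟨hxe, hy⟩)
      · exact hXY hx hy
      · exact he hX (hxe ▸ hx)
      · exact he hY hy
      · exact hXY hx hy
    · ext x
      simp only [Set.mem_sUnion, Set.exists_mem_image, Set.mem_union, Set.mem_ofPred_eq]
      constructor
      · rintro ⟨X, hX, hx | ⟨hx, hf⟩⟩
        exacts [Or.inl ⟨X, hX, hx⟩, Or.inr ⟨hx, X, hX, hf⟩]
      · rintro (⟨X, hX, hx⟩ | ⟨hx, X, hX, hf⟩)
        exacts [⟨X, hX, Or.inl hx⟩, ⟨X, hX, Or.inr ⟨hx, hf⟩⟩]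

end Minors

/-! ### Cycles of binary matroids -/

section Binary

open scoped symmDiff

variable {α : Type*}

theorem isCycle_empty (M : Matroid α) : IsCycle M ∅ := ⟨∅, by simp⟩

theorem IsCycle.union {M : Matroid α} {C D : Set α} (hC : IsCycle M C) (hD : M.IsCircuit D)
    (hCD : Disjoint C D) : IsCycle M (C ∪ D) := by
  obtain ⟨𝒟, h𝒟, hd, rfl⟩ := hC
  refine ⟨insert D 𝒟, ?_, ?_, by rw [Set.sUnion_insert, Set.union_comm]⟩
  · rintro X (rfl | hX)
    exacts [hD, h𝒟 X hX]
  · exact hd.insert fun X hX _ => (Set.disjoint_sUnion_left.1 hCD X hX).symm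

theorem _root_.Matroid.IsCircuit.isCycle {M : Matroid α} {C : Set α} (hC : M.IsCircuit C) :
    IsCycle M C := by
  simpa using (isCycle_empty M).union hC (Set.empty_disjoint C)

theorem IsCycle.induction_on {M : Matroid α} [M.Finite] {P : Set α → Prop} {C : Set α}
    (hC : IsCycle M C) (empty : P ∅)
    (union : ∀ C D, M.IsCircuit D → Disjoint C D → P C → P (C ∪ D)) : P C := by
  obtain ⟨𝒟, h𝒟, hd, rfl⟩ := hC
  have hfin : 𝒟.Finite := M.ground_finite.finite_subsets.subset fun D hD => (h𝒟 D hD).subset_ground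
  induction 𝒟, hfin using Set.Finite.induction_on with
  | empty => simpa using empty
  | @insert D 𝒟 hD _ ih =>
    rw [Set.sUnion_insert, Set.union_comm]
    refine union _ D (h𝒟 D (Set.mem_insert D 𝒟)) ?_
      (ih (fun X hX => h𝒟 X (Set.mem_insert_of_mem D hX)) (hd.subset (Set.subset_insert D 𝒟)))
    exact Set.disjoint_sUnion_left.2 fun X hX => hd (Set.mem_insert_of_mem D hX)
      (Set.mem_insert D 𝒟) (by rintro rfl; exact hD hX)

/-- The sum of the vectors `v a` over the elements `a` of `C` in the ground set of `M`. -/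
noncomputable def vectorSum {V : Type*} [AddCommMonoid V] (M : Matroid α) [M.Finite] (v : α → V)
    (C : Set α) : V :=
  ∑ a ∈ M.ground_finite.toFinset, C.indicator v a

theorem vectorSum_symmDiff {m : ℕ} (M : Matroid α) [M.Finite] (v : α → Fin m → ZMod 2)
    (C D : Set α) : vectorSum M v (C ∆ D) = vectorSum M v C + vectorSum M v D := by
  classical
  rw [vectorSum, vectorSum, vectorSum, ← Finset.sum_add_distrib]
  refine Finset.sum_congr rfl fun a _ => ?_
  have h2 : v a + v a = 0 := funext fun i => CharTwo.add_self_eq_zero _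
  by_cases hC : a ∈ C <;> by_cases hD : a ∈ D <;>
    simp [Set.mem_symmDiff, hC, hD, h2]

/-- Coefficients over `ZMod 2` are 0 or 1, so a linear dependency is just a nonempty subset with
zero sum. -/
theorem IsBinary.exists_dep_iff {M : Matroid α} [M.Finite] (hM : IsBinary M) :
    ∃ (m : ℕ) (v : α → Fin m → ZMod 2), ∀ C ⊆ M.E,
      M.Dep C ↔ ∃ G ⊆ C, G.Nonempty ∧ vectorSum M v G = 0 := by
  classical
  obtain ⟨m, A, hA⟩ := hM
  let w : M.E → Fin m → ZMod 2 := fun e i => A i e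
  let v : α → Fin m → ZMod 2 := fun a => if h : a ∈ M.E then w ⟨a, h⟩ else 0
  have hsum (t : Finset M.E) : vectorSum M v (Subtype.val '' (t : Set M.E)) = ∑ e ∈ t, w e := by
    have himg : (Subtype.val '' (t : Set M.E) : Set α) = ↑(t.map (Function.Embedding.subtype _)) := by
      simp
    rw [vectorSum, himg, Finset.sum_indicator_subset, Finset.sum_map]
    · refine Finset.sum_congr rfl fun e _ => ?_
      simp [v]
    · intro x hx
      obtain ⟨e, -, rfl⟩ := Finset.mem_map.1 hx
      simp
  refine ⟨m, v, fun C hC => ?_⟩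
  have hCimg : Subtype.val '' (Subtype.val ⁻¹' C : Set M.E) = C := by
    rw [Subtype.image_preimage_coe, Set.inter_eq_right.2 hC]
  have hdep := (hA (Subtype.val ⁻¹' C)).not
  rw [hCimg, not_indep_iff hC, linearIndepOn_iff'] at hdep
  rw [hdep]
  push Not
  constructor
  · rintro ⟨t, g, ht, hg, i, hi, hgi⟩
    refine ⟨Subtype.val '' (↑(t.filter fun i => g i ≠ 0) : Set M.E), ?_, ?_, ?_⟩
    · rintro _ ⟨e, he, rfl⟩
      exact ht (Finset.mem_filter.1 he).1
    · exact ⟨i, i, by simpa using ⟨hi, hgi⟩, rfl⟩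
    · rw [hsum, Finset.sum_filter]
      refine (Finset.sum_congr rfl fun e _ => ?_).trans hg
      have h01 : g e = 0 ∨ g e = 1 := by
        generalize g e = x
        revert x
        decide
      rcases h01 with h | h <;> simp [h, w]
  · rintro ⟨G, hGC, ⟨a, ha⟩, hG⟩
    have hfin : (Subtype.val ⁻¹' G : Set M.E).Finite :=
      (M.ground_finite.subset (hGC.trans hC)).preimage Subtype.val_injective.injOn
    refine ⟨hfin.toFinset, fun _ => 1, ?_, ?_, ⟨a, hC (hGC ha)⟩, by simpa using ha, one_ne_zero⟩
    · simpa using Set.preimage_mono hGC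
    · have h := hsum hfin.toFinset
      rw [hfin.coe_toFinset, Subtype.image_preimage_coe,
        Set.inter_eq_right.2 (hGC.trans hC), hG] at h
      simpa [w] using h.symm

/-- Cycles are the zero-sum sets: a circuit has no smaller zero-sum nonempty subset, and from a
nonempty zero-sum set a circuit can be split off, leaving a smaller zero-sum set. -/
theorem IsBinary.exists_isCycle_iff {M : Matroid α} [M.Finite] (hM : IsBinary M) :
    ∃ (m : ℕ) (v : α → Fin m → ZMod 2), ∀ C,
      IsCycle M C ↔ C ⊆ M.E ∧ vectorSum M v C = 0 := by
  obtain ⟨m, v, hv⟩ := hM.exists_dep_iff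
  have hcirc {D : Set α} (hD : M.IsCircuit D) : vectorSum M v D = 0 := by
    obtain ⟨G, hGD, hne, hG⟩ := (hv D hD.subset_ground).1 hD.dep
    rwa [← hD.eq_of_dep_subset ((hv G (hGD.trans hD.subset_ground)).2 ⟨G, subset_rfl, hne, hG⟩)
      hGD]
  refine ⟨m, v, fun C => ⟨fun hC => ⟨hC.subset_ground, ?_⟩, fun h => ?_⟩⟩
  · refine hC.induction_on (P := fun C => vectorSum M v C = 0) (by simp [vectorSum]) fun C D hD hCD ih => ?_
    rw [← show C ∆ D = C ∪ D from hCD.symmDiff_eq_sup, vectorSum_symmDiff, ih, hcirc hD, add_zero]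
  · obtain ⟨hCE, hC⟩ := h
    induction hn : C.ncard using Nat.strong_induction_on generalizing C with
    | _ n ih =>
      rcases C.eq_empty_or_nonempty with rfl | hne
      · exact isCycle_empty M
      obtain ⟨D, hDC, hD⟩ := ((hv C hCE).2 ⟨C, subset_rfl, hne, hC⟩).exists_isCircuit_subset
      have hlt : (C \ D).ncard < n := by
        rw [← hn]
        obtain ⟨x, hx⟩ := hD.nonempty
        exact Set.ncard_lt_ncard ⟨Set.sdiff_subset, fun h => (h (hDC hx)).2 hx⟩
          (M.ground_finite.subset hCE)
      have hsymm : C ∆ D = C \ D := symmDiff_of_ge hDC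
      have := ih _ hlt (C \ D) (Set.sdiff_subset.trans hCE)
        (by rw [← hsymm, vectorSum_symmDiff, hC, hcirc hD, add_zero]) rfl
      simpa [Set.sdiff_union_of_subset hDC] using this.union hD Set.disjoint_sdiff_left

theorem IsBinary.isCycle_symmDiff {M : Matroid α} [M.Finite] (hM : IsBinary M) {C D : Set α}
    (hC : IsCycle M C) (hD : IsCycle M D) : IsCycle M (C ∆ D) := by
  obtain ⟨m, v, hv⟩ := hM.exists_isCycle_iff
  refine (hv _).2 ⟨?_, ?_⟩
  · exact symmDiff_le_sup.trans (Set.union_subset hC.subset_ground hD.subset_ground)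
  · rw [vectorSum_symmDiff, ((hv C).1 hC).2, ((hv D).1 hD).2, add_zero]

/-- A circuit of a contraction is the trace of a circuit. -/
theorem exists_isCircuit_sdiff_eq {M : Matroid α} {T D : Set α} (hD : (M ／ T).IsCircuit D) :
    ∃ C, M.IsCircuit C ∧ C \ T = D := by
  obtain ⟨C, hC, hDC, hCD⟩ := hD.exists_subset_isCircuit_of_contract
  have hDT := (Set.subset_sdiff.1 (contract_ground M T ▸ hD.subset_ground)).2
  refine ⟨C, hC, Set.Subset.antisymm (fun x hx => (hCD hx.1).resolve_right hx.2) fun x hx =>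
    ⟨hDC hx, Set.disjoint_left.1 hDT hx⟩⟩

theorem sdiff_symmDiff_sdiff (C D T : Set α) : (C ∆ D) \ T = (C \ T) ∆ (D \ T) := by
  ext x
  simp only [Set.mem_symmDiff, Set.mem_sdiff]
  tauto

theorem IsBinary.isCycle_contract {M : Matroid α} [M.Finite] (hM : IsBinary M) (T : Set α)
    {C : Set α} (hC : IsCycle M C) : IsCycle (M ／ T) (C \ T) := by
  induction hn : (C \ T).ncard using Nat.strong_induction_on generalizing C with
  | _ n ih =>
    rcases (C \ T).eq_empty_or_nonempty with h0 | ⟨x, hxC, hxT⟩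
    · rw [h0]
      exact isCycle_empty _
    have ⟨𝒟, h𝒟, _, hU⟩ := hC
    obtain ⟨Z, hZ, hxZ⟩ : x ∈ ⋃₀ 𝒟 := hU ▸ hxC
    have hZC : Z ⊆ C := hU ▸ Set.subset_sUnion_of_mem hZ
    -- Choose a circuit `D` of `M ／ T` inside `C \ T` and add a lift `C₀` of it to `C`. The new
    -- cycle has trace `(C \ T) \ D`, to which induction applies.
    obtain ⟨D, hDZ, hD⟩ := ((h𝒟 Z hZ).contract_dep_of_not_subset
      fun h => hxT (h hxZ)).exists_isCircuit_subset
    obtain ⟨C₀, hC₀, hC₀D⟩ := exists_isCircuit_sdiff_eq hD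
    have hDC : D ⊆ C \ T := hDZ.trans (Set.sdiff_subset_sdiff_left hZC)
    have heq : (C ∆ C₀) \ T = (C \ T) \ D := by
      rw [sdiff_symmDiff_sdiff, hC₀D]
      exact symmDiff_of_ge hDC
    have hlt : ((C ∆ C₀) \ T).ncard < n := by
      rw [← hn, heq]
      obtain ⟨y, hy⟩ := hD.nonempty
      exact Set.ncard_lt_ncard ⟨Set.sdiff_subset, fun h => (h (hDC hy)).2 hy⟩
        (hC.finite.subset Set.sdiff_subset)
    have := ih _ hlt (hM.isCycle_symmDiff hC hC₀.isCycle) rfl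
    rw [heq] at this
    simpa [Set.sdiff_union_of_subset hDC] using this.union hD Set.disjoint_sdiff_left

theorem IsBinary.exists_isCycle_sdiff_eq {M : Matroid α} [M.Finite] (hM : IsBinary M) {T D : Set α}
    (hD : IsCycle (M ／ T) D) : ∃ C, IsCycle M C ∧ C \ T = D := by
  refine hD.induction_on (P := fun D => ∃ C, IsCycle M C ∧ C \ T = D) ⟨∅, isCycle_empty M, by simp⟩ ?_
  rintro _ Z hZ hdisj ⟨C, hC, rfl⟩
  obtain ⟨Y, hY, rfl⟩ := exists_isCircuit_sdiff_eq hZ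
  refine ⟨C ∆ Y, hM.isCycle_symmDiff hC hY.isCycle, ?_⟩
  rw [sdiff_symmDiff_sdiff]
  exact hdisj.symmDiff_eq_sup

/-! ### Binary matroidal retracts -/

theorem mu_le_of_isBinaryMatroidalRetract (K : Type*) [Field K] {M N : Matroid α} [M.Finite]
    (h : IsBinaryMatroidalRetract M N) : mu K N ≤ mu K M := by
  obtain ⟨hM, s, e, e', -, he, he', -, hE', hdisj, hcirc, hret, rfl⟩ := h
  have hne (i j : Fin s) : e i ≠ e' j := fun h =>
    Set.disjoint_left.1 hdisj ⟨i, rfl⟩ (h ▸ ⟨j, rfl⟩)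
  have htrace {C : Set α} (hC : IsCycle M C) :
      (∀ j, e j ∈ C ↔ e' j ∈ C) ∨ ∀ j, e j ∈ C ↔ e' j ∉ C := by
    refine hC.induction_on
      (P := fun C => (∀ j, e j ∈ C ↔ e' j ∈ C) ∨ ∀ j, e j ∈ C ↔ e' j ∉ C) (by simp) fun C D hD hCD ih => ?_
    have hD' : (∀ j, e j ∈ D ↔ e' j ∈ D) ∨ ∀ j, e j ∈ D ↔ e' j ∉ D := by
      -- The retract condition covers proper index sets only. A circuit containing all of `E'`
      -- equals `E'`, which misses `E`, so its pattern is complementary.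
      by_cases hJ : e' ⁻¹' D = Set.univ
      · have hsub : Set.range e' ⊆ D := by
          rintro _ ⟨j, rfl⟩
          exact (hJ ▸ Set.mem_univ j : j ∈ e' ⁻¹' D)
        obtain rfl := hcirc.eq_of_subset_isCircuit hD hsub
        refine Or.inr fun j => ?_
        simp [fun i => (hne j i).symm]
      · have hmem (J : Set (Fin s)) (h : D ∩ Set.range e = e '' J) (j : Fin s) :
            e j ∈ D ↔ j ∈ J := by
          rw [← he.mem_set_image (s := J), ← h]
          simp
        exact ((hret D hD _ hJ).1 (by rw [Set.image_preimage_eq_inter_range])).imp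
          (fun h j => hmem _ h j) fun h j => hmem _ h j
    rw [← show C ∆ D = C ∪ D from hCD.symmDiff_eq_sup]
    rcases ih with h₁ | h₁ <;> rcases hD' with h₂ | h₂
    · exact Or.inl fun j => by have := h₁ j; have := h₂ j; simp only [Set.mem_symmDiff]; tauto
    · exact Or.inr fun j => by have := h₁ j; have := h₂ j; simp only [Set.mem_symmDiff]; tauto
    · exact Or.inr fun j => by have := h₁ j; have := h₂ j; simp only [Set.mem_symmDiff]; tauto
    · exact Or.inl fun j => by have := h₁ j; have := h₂ j; simp only [Set.mem_symmDiff]; tauto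
  have hlift {C : Set α} (hC : ∀ j, e j ∈ C ↔ e' j ∈ C) :
      C \ Set.range e' ∪ {t | t ∈ Set.range e' ∧ Function.extend e' e id t ∈ C \ Set.range e'} =
        C := by
    ext x
    by_cases hx : x ∈ Set.range e'
    · obtain ⟨j, rfl⟩ := hx
      simp [he'.extend_apply, hC, fun i => (hne j i).symm]
    · simp only [Set.mem_union, Set.mem_sdiff, Set.mem_ofPred_eq, hx, false_and, or_false,
        not_false_eq_true, and_true]
  -- This `q` sends `e' j` to `e j`; the default `id` outside `E'` plays no role.
  refine mu_contract_le hE' (Function.extend e' e id) (fun C hC => hM.isCycle_contract _ hC) ?_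
  intro D hD
  obtain ⟨C, hC, rfl⟩ := hM.exists_isCycle_sdiff_eq hD
  rcases htrace hC with h | h
  · rwa [hlift h]
  -- Adding `E'` flips membership of every `e' j` and of no `e j`, turning the complementary pattern
  -- into the equal one with the same trace off `E'`.
  · have hC' := hM.isCycle_symmDiff hC hcirc.isCycle
    have heq : (C ∆ Set.range e') \ Set.range e' = C \ Set.range e' := by
      simp
    rw [← heq, hlift]
    · exact hC'
    · intro j
      simp [Set.mem_symmDiff, h j, fun i => (hne j i).symm]

end Binary

end CycleIdeal

theorem mainTheorem9 {α : Type*} (K : Type*) [Field K] (M M' : Matroid α) [M.Finite]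
    (h : CycleIdeal.IsSeriesMinor M M' ∨
      (CycleIdeal.IsBinary M ∧ CycleIdeal.IsBinaryMatroidalRetract M M') ∨
      (CycleIdeal.IsBinary M ∧ CycleIdeal.IsGSeriesMinor M M')) :
    CycleIdeal.mu K M' ≤ CycleIdeal.mu K M := by
  have hstep (A B : Matroid α) (hA : A.Finite) (hAB : CycleIdeal.IsDeletion A B ∨
      CycleIdeal.IsSeriesContraction A B ∨ CycleIdeal.IsColoopContraction A B ∨
      CycleIdeal.IsBinaryMatroidalRetract A B) :
      B.Finite ∧ CycleIdeal.mu K B ≤ CycleIdeal.mu K A := by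
    rcases hAB with ⟨e, -, rfl⟩ | ⟨e, f, hef, h, rfl⟩ | ⟨e, he, rfl⟩ | h
    · exact ⟨inferInstance, CycleIdeal.mu_delete_le A {e}⟩
    · exact ⟨inferInstance, CycleIdeal.mu_series_contract_le hef h⟩
    · refine ⟨inferInstance, ?_⟩
      rw [Matroid.contract_eq_delete_of_subset_coloops (Set.singleton_subset_iff.2 he)]
      exact CycleIdeal.mu_delete_le A {e}
    · refine ⟨?_, CycleIdeal.mu_le_of_isBinaryMatroidalRetract K h⟩
      obtain ⟨-, s, e, e', -, -, -, -, -, -, -, -, rfl⟩ := h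
      infer_instance
  -- Only finiteness is carried along the chain; binarity at a retract step is part of
  -- `IsBinaryMatroidalRetract`.
  have hchain (B : Matroid α) (hB : CycleIdeal.IsGSeriesMinor M B) :
      B.Finite ∧ CycleIdeal.mu K B ≤ CycleIdeal.mu K M := by
    induction hB with
    | refl => exact ⟨inferInstance, le_rfl⟩
    | tail _ hAB ih =>
      have := hstep _ _ ih.1 hAB
      exact ⟨this.1, this.2.trans ih.2⟩
  rcases h with h | ⟨-, h⟩ | ⟨-, h⟩
  · exact (hchain M' (Relation.ReflTransGen.mono (fun A B hAB => hAB.imp_right Or.inl) _ _ h)).2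
  · exact CycleIdeal.mu_le_of_isBinaryMatroidalRetract K h
  · exact (hchain M' h).2
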